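/- Let $X$ be a topological space. A neighborhood assignment on $X$ is a map $U$ assigning to each $x\in X$ an open set $U(x)$ with $x\in U(x)$; a set $A\subseteq X$ pins down $U$ if $A\cap U(x)\neq\emptyset$ for all $x\in X$. The pinning down number $\mathrm{pd}(X)$ is the smallest cardinal $\kappa$ such that every neighborhood assignment on $X$ is pinned down by some set $A \subseteq X$ of cardinality $\kappa$. Let $d(X)$ be the density of $X$, i.e. the smallest cardinality of a dense subset of $X$, and let the dispersion character $\Delta(X)$ be the smallest cardinality of a non-empty open subset of $X$. Theorem. If $X$ is a regular space (any point and any closed set not containing it have disjoint neighborhoods; no $T_1$ axiom is needed) such that $\mathrm{pd}(X)<d(X)$, then $\Delta(X)<2^{\mathrm{pd}(X)}$. -/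

import Mathlib

universe u

open Cardinal

/-- A neighborhood assignment on `X`: every point `x` is assigned an open set `U x` containing it. -/
def IsNeighborhoodAssignment {X : Type u} [TopologicalSpace X] (U : X → Set X) : Prop :=
  ∀ x, IsOpen (U x) ∧ x ∈ U x

/-- The set `A` pins down the neighborhood assignment `U`: it meets every `U x`. -/
def PinsDown {X : Type u} (A : Set X) (U : X → Set X) : Prop :=
  ∀ x, (A ∩ U x).Nonempty

/-- The pinning down number `pd(X)`: the smallest cardinal `κ` such that every neighborhood
assignment on `X` can be pinned down by a set of size `κ`. The set of such `κ` contains `#X`. -/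
noncomputable def pinningDownNumber (X : Type u) [TopologicalSpace X] : Cardinal.{u} :=
  sInf {κ | ∀ U : X → Set X, IsNeighborhoodAssignment U → ∃ A : Set X, #A = κ ∧ PinsDown A U}

/-- The density `d(X)`: the smallest cardinality of a dense subset of `X`. -/
noncomputable def densityNumber (X : Type u) [TopologicalSpace X] : Cardinal.{u} :=
  sInf {κ | ∃ D : Set X, Dense D ∧ #D = κ}

/-- The dispersion character `Δ(X)`: the smallest cardinality of a nonempty open subset of `X`
(with value `0` if `X` is empty). -/
noncomputable def dispersionCharacter (X : Type u) [TopologicalSpace X] : Cardinal.{u} :=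
  sInf {κ | ∃ G : Set X, IsOpen G ∧ G.Nonempty ∧ #G = κ}

/-!
Write `κ = pd(X)`. If `#I ≤ #(G i)` for every member of a family of open sets `G : I → Set X`, then
distinct points can be chosen in the sets `G i`, so the family extends to a neighborhood assignment
and a single set of size at most `κ` meets every `G i`. Assume `2 ^ κ ≤ Δ(X)` with `κ` infinite.

* Let `Y` be open with `#Y ≤ 2 ^ κ`. If no set of size at most `κ` were dense in `Y`, some `A` of
  that size would meet all the open sets `Y \ closure B` with `B ⊆ Y` and `#B ≤ κ`, which is absurd
  for `B = A ∩ Y`.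
* If all nonempty open subsets of `Z` are larger than `2 ^ κ`, apply it to the differences
  `G \ closure H` of regular open sets: a set meeting all of them separates the regular open sets by
  their traces, so `Z` has at most `2 ^ κ` regular open subsets. Apply it again to those: by
  regularity, a set meeting all of them is dense in `Z`.

Every nonempty open set contains an open set of one of these two kinds, and disjoint families of
open sets have size at most `κ`, so a maximal disjoint family of such sets yields a dense set of
size at most `κ`. If `κ` is finite, the `T₀` quotient of `X` is Hausdorff, and disjoint
neighborhoods of its points show that it has at most `κ` of them.
-/

open Set

theorem exists_injective_forall_mem_of_mk_le {I X : Type u} {G : I → Set X}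
    (hG : ∀ i, #I ≤ #(G i)) : ∃ f : I → X, Function.Injective f ∧ ∀ i, f i ∈ G i := by
  obtain ⟨_, _, hord⟩ := exists_ord_eq_type_lt I
  have exists_new (i : I) (g : ∀ j, j < i → X) : ∃ x ∈ G i, ∀ j hj, g j hj ≠ x := by
    by_contra! hcover
    have hsub : G i ⊆ range fun j : Iio i => g j j.2 := fun x hx =>
      let ⟨j, hj, hjx⟩ := hcover x hx
      ⟨⟨j, hj⟩, hjx⟩
    exact (mk_Iio_lt i hord).not_ge ((hG i).trans ((mk_le_mk_of_subset hsub).trans mk_range_le))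
  choose next next_mem next_ne using exists_new
  let f : I → X := IsWellFounded.fix (· < ·) next
  have f_eq (i : I) : f i = next i fun j _ => f j := IsWellFounded.fix_eq (· < ·) next i
  refine ⟨f, Function.Injective.of_lt_imp_ne fun j i hji => ?_, fun i => f_eq i ▸ next_mem i _⟩
  rw [f_eq i]
  exact next_ne i (fun j _ => f j) j hji

section TopologicalSpace

variable {X : Type u} [TopologicalSpace X]

theorem exists_pairwiseDisjoint_dense_sUnion {ℬ : Set (Set X)} (hne : ∀ G ∈ ℬ, G.Nonempty)
    (hℬ : ∀ V : Set X, IsOpen V → V.Nonempty → ∃ G ∈ ℬ, G ⊆ V) :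
    ∃ 𝒞 ⊆ ℬ, 𝒞.PairwiseDisjoint id ∧ Dense (⋃₀ 𝒞) := by
  obtain ⟨𝒞, hmax⟩ := zorn_subset {𝒞 : Set (Set X) | 𝒞 ⊆ ℬ ∧ 𝒞.PairwiseDisjoint id}
    fun c hc hchain => ⟨⋃₀ c, ⟨sUnion_subset fun 𝒟 h𝒟 => (hc h𝒟).1,
      (pairwiseDisjoint_sUnion hchain.directedOn).2 fun 𝒟 h𝒟 => (hc h𝒟).2⟩,
      fun 𝒟 => subset_sUnion_of_mem⟩
  obtain ⟨h𝒞ℬ, hdisj⟩ := hmax.prop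
  refine ⟨𝒞, h𝒞ℬ, hdisj, dense_iff_inter_open.2 fun V hV hVne => ?_⟩
  obtain ⟨G, hG, hGV⟩ := hℬ V hV hVne
  by_contra hempty
  have hGd : ∀ H ∈ 𝒞, Disjoint G H := fun H hH =>
    disjoint_left.2 fun x hxG hxH => hempty ⟨x, hGV hxG, H, hH, hxH⟩
  have hG𝒞 : G ∈ 𝒞 := hmax.le_of_ge
    ⟨insert_subset hG h𝒞ℬ, hdisj.insert fun H hH _ => hGd H hH⟩ (subset_insert G 𝒞)
    (mem_insert G 𝒞)
  exact (hne G hG).ne_empty (disjoint_self.1 (hGd G hG𝒞))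

theorem densityNumber_le_mk {D : Set X} (hD : Dense D) : densityNumber X ≤ #D :=
  csInf_le' ⟨D, hD, rfl⟩

theorem dispersionCharacter_le_mk {G : Set X} (hG : IsOpen G) (hne : G.Nonempty) :
    dispersionCharacter X ≤ #G :=
  csInf_le' ⟨G, hG, hne, rfl⟩

theorem IsNeighborhoodAssignment.exists_pinsDown {U : X → Set X}
    (hU : IsNeighborhoodAssignment U) : ∃ A : Set X, #A = pinningDownNumber X ∧ PinsDown A U :=
  csInf_mem (s := {κ | ∀ U : X → Set X, IsNeighborhoodAssignment U →
    ∃ A : Set X, #A = κ ∧ PinsDown A U})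
    ⟨#X, fun _ hU => ⟨univ, mk_univ, fun x => ⟨x, mem_univ x, (hU x).2⟩⟩⟩ U hU

section OpenFamily

variable {I : Type u} {G : I → Set X}

theorem exists_mk_le_forall_inter_nonempty_of_injective (hG : ∀ i, IsOpen (G i)) {f : I → X}
    (hf : Function.Injective f) (hfG : ∀ i, f i ∈ G i) :
    ∃ A : Set X, #A ≤ pinningDownNumber X ∧ ∀ i, (A ∩ G i).Nonempty := by
  have hU : IsNeighborhoodAssignment (Function.extend f G fun _ => univ) := by
    intro x
    by_cases hx : ∃ i, f i = x
    · obtain ⟨i, rfl⟩ := hx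
      rw [hf.extend_apply]
      exact ⟨hG i, hfG i⟩
    · rw [Function.extend_apply' _ _ _ hx]
      exact ⟨isOpen_univ, mem_univ x⟩
  obtain ⟨A, hA, hAU⟩ := hU.exists_pinsDown
  exact ⟨A, hA.le, fun i => hf.extend_apply G (fun _ => univ) i ▸ hAU (f i)⟩

theorem exists_mk_le_forall_inter_nonempty (hG : ∀ i, IsOpen (G i)) (hcard : ∀ i, #I ≤ #(G i)) :
    ∃ A : Set X, #A ≤ pinningDownNumber X ∧ ∀ i, (A ∩ G i).Nonempty :=
  let ⟨_, hf, hfG⟩ := exists_injective_forall_mem_of_mk_le hcard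
  exists_mk_le_forall_inter_nonempty_of_injective hG hf hfG

theorem mk_le_pinningDownNumber_of_pairwise_disjoint (hG : ∀ i, IsOpen (G i))
    (hne : ∀ i, (G i).Nonempty) (hd : Pairwise (Function.onFun Disjoint G)) :
    #I ≤ pinningDownNumber X := by
  have injective_of_mem {f : I → X} (hf : ∀ i, f i ∈ G i) : Function.Injective f :=
    fun i j hij => hd.eq (not_disjoint_iff.2 ⟨f i, hf i, hij ▸ hf j⟩)
  choose f hf using hne
  obtain ⟨A, hA, hAG⟩ :=
    exists_mk_le_forall_inter_nonempty_of_injective hG (injective_of_mem hf) hf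
  choose g hgA hgG using hAG
  exact (mk_le_of_injective ((injective_of_mem hgG).codRestrict hgA)).trans hA

end OpenFamily

theorem mk_separationQuotient_le_pinningDownNumber [R1Space X]
    (hfin : pinningDownNumber X < ℵ₀) : #(SeparationQuotient X) ≤ pinningDownNumber X := by
  obtain ⟨n, hn⟩ := lt_aleph0.1 hfin
  by_contra! hlt
  have hsucc : ((n + 1 : ℕ) : Cardinal) ≤ #(SeparationQuotient X) := by
    rw [Nat.cast_succ, ← succ_natCast, ← hn]
    exact Order.succ_le_of_lt hlt
  obtain ⟨s, hs⟩ := exists_finset_eq_card hsucc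
  obtain ⟨U, hU, hdisj⟩ := s.finite_toSet.t2_separation
  have hle : #s ≤ pinningDownNumber X :=
    mk_le_pinningDownNumber_of_pairwise_disjoint (G := fun q : s => SeparationQuotient.mk ⁻¹' U q)
      (fun q => (hU q).2.preimage SeparationQuotient.continuous_mk)
      (fun q => (nonempty_of_mem (hU q).1).preimage SeparationQuotient.surjective_mk)
      fun p q hpq => (hdisj p.2 q.2 (Subtype.coe_ne_coe.2 hpq)).preimage _
  rw [mk_coe_finset, ← hs, hn, Nat.cast_le] at hle
  exact n.lt_irrefl hle

theorem densityNumber_le_mk_separationQuotient :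
    densityNumber X ≤ #(SeparationQuotient X) := by
  let r := Function.surjInv (SeparationQuotient.surjective_mk (X := X))
  have hr : Dense (range r) := fun x =>
    have hx : Inseparable (r (SeparationQuotient.mk x)) x :=
      SeparationQuotient.mk_eq_mk.1 (Function.surjInv_eq _ _)
    hx.specializes.mem_closed isClosed_closure (subset_closure (mem_range_self _))
  exact (densityNumber_le_mk hr).trans mk_range_le

theorem exists_mk_le_subset_closure_of_power_le {Y : Set X} (hY : IsOpen Y)
    (hbig : ∀ G ⊆ Y, IsOpen G → G.Nonempty → max #Y ℵ₀ ^ pinningDownNumber X ≤ #G) :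
    ∃ A : Set X, #A ≤ pinningDownNumber X ∧ Y ⊆ closure A := by
  by_contra! hcon
  let I := {A : Set X // A ⊆ Y ∧ #A ≤ pinningDownNumber X}
  have hopen (B : I) : IsOpen (Y \ closure B.1) := hY.sdiff isClosed_closure
  obtain ⟨A, hA, hmeets⟩ := exists_mk_le_forall_inter_nonempty hopen fun B =>
    (mk_bounded_subset_le Y _).trans
      (hbig _ sdiff_subset (hopen B) (sdiff_nonempty.2 (hcon B.1 B.2.2)))
  obtain ⟨x, hxA, hxY, hx⟩ :=
    hmeets ⟨A ∩ Y, inter_subset_right, (mk_le_mk_of_subset inter_subset_left).trans hA⟩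
  exact hx (subset_closure ⟨hxA, hxY⟩)

theorem subset_of_inter_subset_of_regularOpen {A G H : Set X} (hG : IsOpen G)
    (hH : interior (closure H) = H)
    (hA : (G \ closure H).Nonempty → (A ∩ (G \ closure H)).Nonempty) (hGH : A ∩ G ⊆ H) :
    G ⊆ H := by
  have hcl : G ⊆ closure H := by
    by_contra hnot
    obtain ⟨x, hxA, hxG, hxH⟩ := hA (sdiff_nonempty.2 hnot)
    exact hxH (subset_closure (hGH ⟨hxA, hxG⟩))
  exact hH ▸ interior_maximal hcl hG

theorem mk_le_two_power_of_regularOpen {𝒢 : Set (Set X)}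
    (hreg : ∀ G ∈ 𝒢, interior (closure G) = G)
    (hbig : ∀ G ∈ 𝒢, ∀ H ∈ 𝒢, (G \ closure H).Nonempty → #𝒢 * #𝒢 ≤ #↥(G \ closure H)) :
    #𝒢 ≤ 2 ^ pinningDownNumber X := by
  have hopen (G : 𝒢) : IsOpen G.1 := hreg G.1 G.2 ▸ isOpen_interior
  let I := {p : 𝒢 × 𝒢 // (p.1.1 \ closure p.2.1).Nonempty}
  have hI : #I ≤ #𝒢 * #𝒢 := (mk_subtype_le _).trans (mul_def 𝒢 𝒢).ge
  obtain ⟨A, hA, hmeets⟩ := exists_mk_le_forall_inter_nonempty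
    (G := fun p : I => p.1.1.1 \ closure p.1.2.1)
    (fun p => (hopen p.1.1).sdiff isClosed_closure)
    fun p => hI.trans (hbig _ p.1.1.2 _ p.1.2.2 p.2)
  have subset_of_trace (G H : 𝒢) (hGH : A ∩ G.1 ⊆ A ∩ H.1) : G.1 ⊆ H.1 :=
    subset_of_inter_subset_of_regularOpen (hopen G) (hreg H.1 H.2)
      (fun hne => hmeets ⟨(G, H), hne⟩) (hGH.trans inter_subset_right)
  have trace_injective : Function.Injective fun G : 𝒢 => ((↑) ⁻¹' G.1 : Set A) := fun G H hGH =>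
    have htrace : A ∩ G.1 = A ∩ H.1 := Subtype.preimage_coe_eq_preimage_coe_iff.1 hGH
    Subtype.ext ((subset_of_trace G H htrace.le).antisymm (subset_of_trace H G htrace.ge))
  calc #𝒢 ≤ #(Set A) := mk_le_of_injective trace_injective
    _ = 2 ^ #A := mk_set
    _ ≤ 2 ^ pinningDownNumber X := power_le_power_left two_ne_zero hA

theorem mk_regularOpen_subset_le_two_power (hinf : ℵ₀ ≤ pinningDownNumber X) {Z : Set X}
    (hbig : ∀ G ⊆ Z, IsOpen G → G.Nonempty → 2 ^ pinningDownNumber X < #G) :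
    #{G : Set X | interior (closure G) = G ∧ G ⊆ Z} ≤ 2 ^ pinningDownNumber X := by
  by_contra! hlt
  obtain ⟨𝒢, h𝒢, hcard⟩ := le_mk_iff_exists_subset.1 (Order.succ_le_of_lt hlt)
  have hsq : #𝒢 * #𝒢 = Order.succ (2 ^ pinningDownNumber X) := by
    rw [hcard]
    exact mul_eq_self ((hinf.trans (cantor _).le).trans (Order.le_succ _))
  have hle : #𝒢 ≤ 2 ^ pinningDownNumber X :=
    mk_le_two_power_of_regularOpen (fun G hG => (h𝒢 hG).1) fun G hG H _ hne => by
      have hGopen : IsOpen G := (h𝒢 hG).1 ▸ isOpen_interior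
      rw [hsq]
      exact Order.succ_le_of_lt
        (hbig _ (sdiff_subset.trans (h𝒢 hG).2) (hGopen.sdiff isClosed_closure) hne)
  exact (Order.lt_succ _).not_ge (hcard ▸ hle)

theorem exists_regularOpen_mem_subset [RegularSpace X] {V : Set X} (hV : IsOpen V) {x : X}
    (hx : x ∈ V) : ∃ G : Set X, interior (closure G) = G ∧ x ∈ G ∧ G ⊆ V := by
  obtain ⟨C, hCx, hC, hCV⟩ := exists_mem_nhds_isClosed_subset (hV.mem_nhds hx)
  exact ⟨interior (closure (interior C)), interior_closure_idem,
    interior_maximal subset_closure isOpen_interior (mem_interior_iff_mem_nhds.2 hCx),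
    interior_subset.trans ((closure_minimal interior_subset hC).trans hCV)⟩

theorem exists_mk_le_subset_closure_of_two_power_lt [RegularSpace X]
    (hinf : ℵ₀ ≤ pinningDownNumber X) {Z : Set X} (hZ : IsOpen Z)
    (hbig : ∀ G ⊆ Z, IsOpen G → G.Nonempty → 2 ^ pinningDownNumber X < #G) :
    ∃ A : Set X, #A ≤ pinningDownNumber X ∧ Z ⊆ closure A := by
  let I := {G : {G : Set X | interior (closure G) = G ∧ G ⊆ Z} // G.1.Nonempty}
  have hI : #I ≤ 2 ^ pinningDownNumber X :=
    (mk_subtype_le _).trans (mk_regularOpen_subset_le_two_power hinf hbig)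
  have hopen (G : I) : IsOpen G.1.1 := G.1.2.1 ▸ isOpen_interior
  obtain ⟨A, hA, hmeets⟩ := exists_mk_le_forall_inter_nonempty hopen
    fun G => hI.trans (hbig _ G.1.2.2 (hopen G) G.2).le
  refine ⟨A, hA, fun x hx => mem_closure_iff.2 fun V hV hxV => ?_⟩
  obtain ⟨G, hreg, hxG, hGVZ⟩ := exists_regularOpen_mem_subset (hV.inter hZ) ⟨hxV, hx⟩
  obtain ⟨y, hyA, hyG⟩ := hmeets ⟨⟨G, hreg, hGVZ.trans inter_subset_right⟩, x, hxG⟩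
  exact ⟨y, (hGVZ hyG).1, hyA⟩

theorem exists_isOpen_mk_le_subset_closure [RegularSpace X] (hinf : ℵ₀ ≤ pinningDownNumber X)
    (hΔ : 2 ^ pinningDownNumber X ≤ dispersionCharacter X) {V : Set X} (hV : IsOpen V)
    (hne : V.Nonempty) :
    ∃ G ⊆ V, IsOpen G ∧ G.Nonempty ∧ ∃ A : Set X, #A ≤ pinningDownNumber X ∧ G ⊆ closure A := by
  by_cases hsmall : ∃ G ⊆ V, IsOpen G ∧ G.Nonempty ∧ #G ≤ 2 ^ pinningDownNumber X
  · obtain ⟨G, hGV, hG, hGne, hGcard⟩ := hsmall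
    have hpow : max #G ℵ₀ ^ pinningDownNumber X ≤ 2 ^ pinningDownNumber X :=
      calc max #G ℵ₀ ^ pinningDownNumber X
          ≤ (2 ^ pinningDownNumber X) ^ pinningDownNumber X :=
            power_le_power_right (max_le hGcard (hinf.trans (cantor _).le))
        _ = 2 ^ pinningDownNumber X := by rw [← power_mul, mul_eq_self hinf]
    exact ⟨G, hGV, hG, hGne, exists_mk_le_subset_closure_of_power_le hG fun W _ hW hWne =>
      (hpow.trans hΔ).trans (dispersionCharacter_le_mk hW hWne)⟩
  · push Not at hsmall
    exact ⟨V, Subset.rfl, hV, hne, exists_mk_le_subset_closure_of_two_power_lt hinf hV hsmall⟩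

theorem densityNumber_le_pinningDownNumber_of_forall_exists_subset_closure
    (hinf : ℵ₀ ≤ pinningDownNumber X)
    (hlocal : ∀ V : Set X, IsOpen V → V.Nonempty → ∃ G ⊆ V, IsOpen G ∧ G.Nonempty ∧
      ∃ A : Set X, #A ≤ pinningDownNumber X ∧ G ⊆ closure A) :
    densityNumber X ≤ pinningDownNumber X := by
  obtain ⟨𝒞, h𝒞, hdisj, hdense⟩ := exists_pairwiseDisjoint_dense_sUnion
    (ℬ := {G : Set X | IsOpen G ∧ G.Nonempty ∧
      ∃ A : Set X, #A ≤ pinningDownNumber X ∧ G ⊆ closure A})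
    (fun G hG => hG.2.1) fun V hV hne =>
      let ⟨G, hGV, hG⟩ := hlocal V hV hne
      ⟨G, hG, hGV⟩
  have hcell : #𝒞 ≤ pinningDownNumber X := mk_le_pinningDownNumber_of_pairwise_disjoint
    (fun G : 𝒞 => (h𝒞 G.2).1) (fun G => (h𝒞 G.2).2.1)
    fun G H hGH => hdisj G.2 H.2 (Subtype.coe_ne_coe.2 hGH)
  choose A hA hGA using fun G : 𝒞 => (h𝒞 G.2).2.2
  have hD : Dense (⋃ G, A G) := dense_closure.1 <| hdense.mono <| sUnion_subset fun G hG =>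
    (hGA ⟨G, hG⟩).trans (closure_mono (subset_iUnion A ⟨G, hG⟩))
  calc densityNumber X ≤ #(⋃ G, A G) := densityNumber_le_mk hD
    _ ≤ #𝒞 * ⨆ G, #(A G) := mk_iUnion_le A
    _ ≤ pinningDownNumber X * pinningDownNumber X := mul_le_mul' hcell (ciSup_le' hA)
    _ = pinningDownNumber X := mul_eq_self hinf

end TopologicalSpace

theorem mainTheorem6 (X : Type u) [TopologicalSpace X] [RegularSpace X]
    (h : pinningDownNumber X < densityNumber X) :
    dispersionCharacter X < (2 : Cardinal.{u}) ^ pinningDownNumber X := by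
  by_contra! hΔ
  refine h.not_ge ?_
  rcases lt_or_ge (pinningDownNumber X) ℵ₀ with hfin | hinf
  · exact densityNumber_le_mk_separationQuotient.trans
      (mk_separationQuotient_le_pinningDownNumber hfin)
  · exact densityNumber_le_pinningDownNumber_of_forall_exists_subset_closure hinf
      fun _ => exists_isOpen_mk_le_subset_closure hinf hΔ
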